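/- Let $K\ge 2$, $\Delta_{K-1}=\{\theta\in\mathbb R^K:\theta_i\ge 0,\ \sum_i\theta_i=1\}$ and $\alpha\in(0,\infty)^K$. Let $\mathrm{Dir}_\alpha$ be the Dirichlet distribution on $\Delta_{K-1}$, with density $\mathrm{Dir}_\alpha(\theta)=B(\alpha)^{-1}\prod_i\theta_i^{\alpha_i-1}$ with respect to Lebesgue measure in the coordinates $(\theta_1,\dots,\theta_{K-1})$, where $B(\alpha)=\prod_i\Gamma(\alpha_i)/\Gamma(\sum_i\alpha_i)$. Let $H:\mathbb R^K\to\mathbb R\cup\{-\infty\}$ and $\theta^*\in\Delta_{K-1}$ satisfy: (A1) $H(\theta)<H(\theta^*)$ for all $\theta\in\Delta_{K-1}\setminus\{\theta^*\}$; (A2) $H$ is continuous on $\Delta_{K-1}$ (as a map into $\mathbb R\cup\{-\infty\}$), and finite and twice continuously differentiable in an open neighborhood of $\theta^*$ in $\mathbb R^K$; (A3) there are $\mu\in\mathbb R$ and $\lambda_i>0$ for each $i$ with $\theta^*_i=0$ such that $\nabla H(\theta^*)=-\sum_{i:\theta_i^*=0}\lambda_i e_i+\mu\mathbf 1$; (A4)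 $d^\top\nabla^2H(\theta^*)d<0$ for all $d\in\mathbb R^K\setminus\{0\}$ with $\sum_i d_i=0$ and $d_i=0$ whenever $\theta_i^*=0$. Fix $\epsilon$ with $0<\epsilon<\min_{i:\theta^*_i>0}\theta_i^*$ and put $\Delta^\epsilon_{K-1}=\{\theta\in\Delta_{K-1}:\theta_i\ge\epsilon\text{ whenever }\theta_i^*>0\}$. For real $n>0$, an integer $N\ge1$ and $\gamma\in(0,1)$, let $I(n)=\mathbb E_{\mathrm{Dir}_\alpha}[e^{nH(\theta)}]$ (with $e^{-\infty}=0$), and $$\hat p_{\mathrm{MC}}=\frac1N\sum_{i=1}^N e^{nH(\theta^{(i)})},\quad \theta^{(1)},\dots,\theta^{(N)}\ \text{i.i.d.}\sim\mathrm{Dir}_\alpha,$$ $$\hat p^{\gamma}_{\mathrm{IS}}=\frac1N\sum_{i=1}^N e^{nH(\theta^{(i)})}\,\frac{\mathrm{Dir}_\alpha(\theta^{(i)})}{\mathrm{Dir}_{\alpha+n^\gamma\theta^*}(\theta^{(i)})}\,\mathbf 1_{\Delta^\epsilon_{K-1}}(\theta^{(i)}),\quad \theta^{(1)},\dots,\theta^{(N)}\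 \text{i.i.d.}\sim\mathrm{Dir}_{\alpha+n^\gamma\theta^*},$$ and $\mathrm{Bias}(\hat p^\gamma_{\mathrm{IS}})=\mathbb E[\hat p^\gamma_{\mathrm{IS}}]-I(n)$. Then for all $n>0$, $N\ge 1$ and $\gamma\in(0,1)$ the estimator $\hat p^\gamma_{\mathrm{IS}}$ is integrable and $\hat p_{\mathrm{MC}}$ is square-integrable with $\mathrm{Var}(\hat p_{\mathrm{MC}})>0$, and there exists $\delta>0$, independent of $\gamma$ and $N$, such that for all $\gamma\in(0,1)$ and $N\ge1$ $$\frac{\mathrm{Bias}(\hat p^\gamma_{\mathrm{IS}})^2}{\mathrm{Var}(\hat p_{\mathrm{MC}})}=O(e^{-2n\delta})\qquad(n\to\infty).$$ -/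

import Mathlib

open MeasureTheory ProbabilityTheory Filter Topology Asymptotics

namespace DirichletIS

noncomputable section

/-! The simplex of dimension `K - 1` is `stdSimplex ℝ (Fin K)`; throughout `K = k + 1`. -/

/-- The projected simplex: the points `y` of `ℝ^k` with `y i ≥ 0` and `∑ y i ≤ 1`. -/
def projSimplex (k : ℕ) : Set (Fin k → ℝ) :=
  {y | (∀ i, 0 ≤ y i) ∧ ∑ i, y i ≤ 1}

/-- The coordinate map `y ↦ (y, 1 - ∑ y i)` from the projected simplex to the simplex. -/
def simplexChart {k : ℕ} (y : Fin k → ℝ) : Fin (k + 1) → ℝ :=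
  Fin.snoc (α := fun _ => ℝ) y (1 - ∑ i, y i)

/-- The multivariate Beta function `∏ Γ(α i) / Γ(∑ α i)`. -/
def multiBeta {ι : Type*} [Fintype ι] (α : ι → ℝ) : ℝ :=
  (∏ i, Real.Gamma (α i)) / Real.Gamma (∑ i, α i)

/-- The Dirichlet density `B(α)⁻¹ ∏ θ i ^ (α i - 1)` at a point `θ` of the simplex. -/
def dirDensity {ι : Type*} [Fintype ι] (α θ : ι → ℝ) : ℝ :=
  (1 / multiBeta α) * ∏ i, θ i ^ (α i - 1)

/-- The Dirichlet distribution on the simplex: in the coordinates of the projected simplex it has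
the Dirichlet density with respect to Lebesgue measure. -/
def dirichlet {k : ℕ} (α : Fin (k + 1) → ℝ) : Measure (Fin (k + 1) → ℝ) :=
  Measure.map simplexChart
    ((volume.restrict (projSimplex k)).withDensity
      fun y => ENNReal.ofReal (dirDensity α (simplexChart y)))

/-- `e^{n x}` for `n > 0` and `x` in `ℝ ∪ {-∞}`, with `e^{-∞} = 0`. -/
def expScaled (n : ℝ) (x : EReal) : ℝ := (EReal.exp ((n : EReal) * x)).toReal

/-- The estimand `I(n) = E_{Dir_α}[e^{n H(θ)}]`. -/
def estimand {k : ℕ} (α : Fin (k + 1) → ℝ) (H : (Fin (k + 1) → ℝ) → EReal) (n : ℝ) : ℝ :=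
  ∫ θ, expScaled n (H θ) ∂(dirichlet α)

/-- The law of `N` independent samples from the Dirichlet distribution. -/
def iidDirichlet {k : ℕ} (N : ℕ) (α : Fin (k + 1) → ℝ) :
    Measure (Fin N → Fin (k + 1) → ℝ) :=
  Measure.pi fun _ => dirichlet α

/-- The plain Monte Carlo estimator, as a function of the samples (drawn from `Dir_α`). -/
def mcEstimator {k : ℕ} (N : ℕ) (H : (Fin (k + 1) → ℝ) → EReal) (n : ℝ)
    (s : Fin N → Fin (k + 1) → ℝ) : ℝ :=
  (1 / (N : ℝ)) * ∑ i, expScaled n (H (s i))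

/-- The truncated simplex: `θ i ≥ ε` for every `i` with `θstar i > 0`. -/
def truncSimplex {k : ℕ} (θstar : Fin (k + 1) → ℝ) (ε : ℝ) : Set (Fin (k + 1) → ℝ) :=
  {θ | θ ∈ stdSimplex ℝ (Fin (k + 1)) ∧ ∀ i, 0 < θstar i → ε ≤ θ i}

/-- The parameter `α + n^γ θstar` of the importance sampling proposal. -/
def isParam {k : ℕ} (α θstar : Fin (k + 1) → ℝ) (γ n : ℝ) : Fin (k + 1) → ℝ :=
  fun i => α i + n ^ γ * θstar i

/-- The truncated importance sampling estimator with exponent `γ`, as a function of the samples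
(drawn from the Dirichlet distribution with parameter `α + n^γ θstar`). -/
def isEstimator {k : ℕ} (N : ℕ) (α θstar : Fin (k + 1) → ℝ) (ε γ : ℝ)
    (H : (Fin (k + 1) → ℝ) → EReal) (n : ℝ) (s : Fin N → Fin (k + 1) → ℝ) : ℝ :=
  (1 / (N : ℝ)) * ∑ i,
    (truncSimplex θstar ε).indicator
      (fun θ => expScaled n (H θ) * (dirDensity α θ / dirDensity (isParam α θstar γ n) θ)) (s i)

/-- The bias `E[p] - I(n)` of the importance sampling estimator. -/
def isBias {k : ℕ} (N : ℕ) (α θstar : Fin (k + 1) → ℝ) (ε γ : ℝ)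
    (H : (Fin (k + 1) → ℝ) → EReal) (n : ℝ) : ℝ :=
  (∫ s, isEstimator N α θstar ε γ H n s ∂(iidDirichlet N (isParam α θstar γ n)))
    - estimand α H n

/-- The variance of the plain Monte Carlo estimator. -/
def mcVar {k : ℕ} (N : ℕ) (α : Fin (k + 1) → ℝ) (H : (Fin (k + 1) → ℝ) → EReal) (n : ℝ) : ℝ :=
  variance (mcEstimator N H n) (iidDirichlet N α)

/-- `H` attains its maximum over the simplex at `θstar` and only there. -/
def UniqueMax {k : ℕ} (H : (Fin (k + 1) → ℝ) → EReal) (θstar : Fin (k + 1) → ℝ) : Prop :=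
  θstar ∈ stdSimplex ℝ (Fin (k + 1)) ∧
    ∀ θ ∈ stdSimplex ℝ (Fin (k + 1)), θ ≠ θstar → H θ < H θstar

/-- `H` is continuous on the simplex (as an extended-real-valued function), and finite and twice
continuously differentiable in an open neighborhood of `θstar` in `ℝ^K`. -/
def Regular {k : ℕ} (H : (Fin (k + 1) → ℝ) → EReal) (θstar : Fin (k + 1) → ℝ) : Prop :=
  ContinuousOn H (stdSimplex ℝ (Fin (k + 1))) ∧
    ∃ U : Set (Fin (k + 1) → ℝ), IsOpen U ∧ θstar ∈ U ∧ (∀ θ ∈ U, H θ ≠ ⊥) ∧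
      ContDiffOn ℝ 2 (fun θ => (H θ).toReal) U

/-- Strict complementarity: the KKT condition
`∇H(θstar) = - ∑_{i : θstar i = 0} lam i • e_i + μ • 1` holds with strictly positive multipliers
`lam i` of the active constraints. (The gradients of the active constraints are linearly
independent, so these multipliers are unique.) -/
def StrictComplementarity {k : ℕ} (H : (Fin (k + 1) → ℝ) → EReal)
    (θstar : Fin (k + 1) → ℝ) : Prop :=
  ∃ (lam : Fin (k + 1) → ℝ) (μ : ℝ),
    (∀ i, fderiv ℝ (fun θ => (H θ).toReal) θstar (Pi.single i 1)
      = -(if θstar i = 0 then lam i else 0) + μ) ∧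
    ∀ i, θstar i = 0 → 0 < lam i

/-- The critical cone at `θstar`. -/
def criticalCone {k : ℕ} (θstar : Fin (k + 1) → ℝ) : Set (Fin (k + 1) → ℝ) :=
  {d | ∑ i, d i = 0 ∧ ∀ i, θstar i = 0 → d i = 0}

/-- The Hessian of `H` at `θstar` is negative definite on the critical cone. -/
def HessianNegDef {k : ℕ} (H : (Fin (k + 1) → ℝ) → EReal) (θstar : Fin (k + 1) → ℝ) : Prop :=
  ∀ d ∈ criticalCone θstar, d ≠ 0 →
    fderiv ℝ (fderiv ℝ fun θ => (H θ).toReal) θstar d d < 0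

end

end DirichletIS

open DirichletIS

/-! The importance weights cancel the change of sampling law, so truncation is the only source of
bias: it equals minus the integral of `e^{nH}` over the complement of the truncated simplex under
the original Dirichlet law (`isBias_eq`), whatever `γ` and `N` are. There some coordinate with
`θstar i > 0` is at most `ε`. These points lie in a compact set missing `θstar`, so `H ≤ c < h = H
θstar` on them (`exists_lt_of_notMem_truncSimplex`) and the bias is at most `e^{nc}`.

For the variance a crude bound is enough. Given levels `l < b < h` with `l` above some value of `H`
on the simplex, the events `H > b` and `H < l` have positive probability independent of `n`
(`dirichlet_preimage_pos`), so the variance is at least a constant times `(e^{nb} - e^{nl})² / N`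
(`le_variance_of_separated`, `mcVar_eq`). The quotient is then of order `e^{-2n(b-c)}`, and `b` may
be chosen above the midpoint of `c` and `h`. -/

namespace DirichletIS

open Set

/-! ### The Dirichlet integral. -/

/-- The open corner simplex of size `s`. -/
def openCorner (k : ℕ) (s : ℝ) : Set (Fin k → ℝ) :=
  {y | (∀ i, 0 < y i) ∧ ∑ i, y i < s}

lemma isOpen_openCorner (k : ℕ) (s : ℝ) : IsOpen (openCorner k s) := by
  have h : openCorner k s = (⋂ i, {y | 0 < y i}) ∩ {y | ∑ i, y i < s} := by
    ext; simp [openCorner]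
  rw [h]
  exact (isOpen_iInter_of_finite fun i => isOpen_lt continuous_const (continuous_apply i)).inter
    (isOpen_lt (by fun_prop) continuous_const)

/-- The substitution `t = s * u` reduces this to the total mass of the beta density. -/
lemma lintegral_Ioo_rpow_mul {a b s : ℝ} (ha : 0 < a) (hb : 0 < b) (hs : 0 < s) :
    ∫⁻ t in Ioo 0 s, ENNReal.ofReal (t ^ (a - 1) * (s - t) ^ (b - 1)) =
      ENNReal.ofReal (s ^ (a + b - 1) * beta a b) := by
  have hB := beta_pos ha hb
  have himg : (fun u => s * u) '' Ioo 0 1 = Ioo 0 s := by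
    rw [image_mul_left_Ioo hs]; simp
  rw [← himg, lintegral_image_eq_lintegral_abs_deriv_mul (f' := fun _ => s) measurableSet_Ioo
    (fun x _ => by simpa using ((hasDerivAt_id x).const_mul s).hasDerivWithinAt)
    (fun x _ y _ h => mul_left_cancel₀ hs.ne' h)]
  have h1 := lintegral_betaPDF_eq_one ha hb
  rw [lintegral_betaPDF] at h1
  rw [← mul_one (ENNReal.ofReal (s ^ (a + b - 1) * beta a b)), ← h1,
    ← lintegral_const_mul' _ _ ENNReal.ofReal_ne_top]
  refine setLIntegral_congr_fun measurableSet_Ioo fun u hu => ?_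
  have hu' : 0 < 1 - u := sub_pos.2 hu.2
  have hu0 : 0 < u := hu.1
  have e : a + b - 1 = 1 + (a - 1) + (b - 1) := by ring
  rw [← ENNReal.ofReal_mul (abs_nonneg _), ← ENNReal.ofReal_mul (by positivity), abs_of_pos hs,
    show s - s * u = s * (1 - u) by ring, Real.mul_rpow hs.le hu0.le,
    Real.mul_rpow hs.le hu'.le, e, Real.rpow_add hs, Real.rpow_add hs, Real.rpow_one]
  congr 1
  field_simp

/-- The Dirichlet integral over the corner simplex of size `s`. -/
lemma lintegral_openCorner (k : ℕ) (a : Fin k → ℝ) (ha : ∀ i, 0 < a i) {b s : ℝ} (hb : 0 < b)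
    (hs : 0 < s) :
    ∫⁻ y in openCorner k s,
        ENNReal.ofReal ((∏ i, y i ^ (a i - 1)) * (s - ∑ i, y i) ^ (b - 1)) =
      ENNReal.ofReal (s ^ (∑ i, a i + b - 1) *
        ((∏ i, Real.Gamma (a i)) * Real.Gamma b / Real.Gamma (∑ i, a i + b))) := by
  -- Integrate out coordinate `0` last: its slice at height `t` is a corner of size `s - t`, so `s`
  -- must vary in the induction.
  induction k generalizing s with
  | zero =>
    have hG := (Real.Gamma_pos_of_pos hb).ne'
    have hu : openCorner 0 s = univ := by ext; simp [openCorner, hs]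
    simp [hu, volume_pi, hG]
  | succ k ih =>
    set A : ℝ := ∑ i : Fin k, a i.succ with hA
    set G : ℝ := (∏ i : Fin k, Real.Gamma (a i.succ)) * Real.Gamma b / Real.Gamma (A + b) with hG
    have hA0 : 0 ≤ A := Finset.sum_nonneg fun i _ => (ha _).le
    have hG0 : 0 < G := by
      have h1 : 0 < ∏ i : Fin k, Real.Gamma (a i.succ) :=
        Finset.prod_pos fun i _ => Real.Gamma_pos_of_pos (ha _)
      have h2 := Real.Gamma_pos_of_pos hb
      have h3 := Real.Gamma_pos_of_pos (show 0 < A + b by linarith)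
      positivity
    set F : (Fin (k + 1) → ℝ) → ENNReal := fun y =>
      ENNReal.ofReal ((∏ i, y i ^ (a i - 1)) * (s - ∑ i, y i) ^ (b - 1)) with hF
    have hFm : Measurable F := by fun_prop
    have hmp := (volume_preserving_piFinSuccAbove (fun _ : Fin (k + 1) => ℝ) 0).symm
    rw [← lintegral_indicator (isOpen_openCorner _ _).measurableSet,
      ← hmp.lintegral_comp (hFm.indicator (isOpen_openCorner _ _).measurableSet),
      Measure.volume_eq_prod, lintegral_prod _ (Measurable.aemeasurable (by
        exact (hFm.indicator (isOpen_openCorner _ _).measurableSet).comp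
          (MeasurableEquiv.measurable _)))]
    have hpt : ∀ t : ℝ, ∫⁻ z : Fin k → ℝ, (openCorner (k + 1) s).indicator F
        ((MeasurableEquiv.piFinSuccAbove (fun _ : Fin (k + 1) => ℝ) 0).symm (t, z)) =
        (Ioo 0 s).indicator (fun t => ENNReal.ofReal G *
          ENNReal.ofReal (t ^ (a 0 - 1) * (s - t) ^ (A + b - 1))) t := by
      intro t
      have hsymm : ∀ z : Fin k → ℝ,
          (MeasurableEquiv.piFinSuccAbove (fun _ : Fin (k + 1) => ℝ) 0).symm (t, z)
            = (Fin.cons t z : Fin (k + 1) → ℝ) := by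
        intro z
        simp [MeasurableEquiv.piFinSuccAbove, Fin.insertNthEquiv]
      simp only [hsymm]
      by_cases ht : t ∈ Ioo 0 s
      · have hst : 0 < s - t := sub_pos.2 ht.2
        have ht0 : 0 < t := ht.1
        rw [indicator_of_mem ht]
        have hcongr : ∀ z : Fin k → ℝ,
            (openCorner (k + 1) s).indicator F (Fin.cons t z : Fin (k + 1) → ℝ) =
            (openCorner k (s - t)).indicator (fun z => ENNReal.ofReal (t ^ (a 0 - 1)) *
              ENNReal.ofReal ((∏ i, z i ^ (a i.succ - 1)) * (s - t - ∑ i, z i) ^ (b - 1))) z := by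
          intro z
          have hiff : (Fin.cons t z : Fin (k + 1) → ℝ) ∈ openCorner (k + 1) s ↔
              z ∈ openCorner k (s - t) := by
            simp [openCorner, Fin.forall_fin_succ, Fin.sum_univ_succ, ht0, lt_sub_iff_add_lt']
          by_cases hz : z ∈ openCorner k (s - t)
          · rw [indicator_of_mem hz, indicator_of_mem (hiff.2 hz), hF,
              ← ENNReal.ofReal_mul (by positivity)]
            simp only [Fin.prod_univ_succ, Fin.sum_univ_succ, Fin.cons_zero, Fin.cons_succ]
            rw [sub_add_eq_sub_sub, mul_assoc]
          · rw [indicator_of_notMem hz, indicator_of_notMem (fun h => hz (hiff.1 h))]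
        simp only [hcongr]
        rw [lintegral_indicator (isOpen_openCorner _ _).measurableSet,
          lintegral_const_mul' _ _ ENNReal.ofReal_ne_top,
          ih (fun i => a i.succ) (fun i => ha _) hst, ← ENNReal.ofReal_mul (by positivity),
          ← ENNReal.ofReal_mul hG0.le]
        congr 1
        ring
      · rw [indicator_of_notMem ht]
        refine (lintegral_congr fun z => indicator_of_notMem (fun h => ht ⟨?_, ?_⟩) _).trans
          lintegral_zero
        · simpa using h.1 0
        · have h2 := h.2
          have h3 : 0 ≤ ∑ i, z i := Finset.sum_nonneg fun i _ => by simpa using (h.1 i.succ).le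
          simp only [Fin.sum_univ_succ, Fin.cons_zero, Fin.cons_succ] at h2
          linarith
    rw [lintegral_congr hpt, lintegral_indicator measurableSet_Ioo,
      lintegral_const_mul' _ _ ENNReal.ofReal_ne_top,
      lintegral_Ioo_rpow_mul (ha 0) (by linarith) hs, ← ENNReal.ofReal_mul hG0.le]
    congr 1
    rw [hG, beta, Fin.sum_univ_succ, Fin.prod_univ_succ, ← hA, ← add_assoc]
    have h3 := (Real.Gamma_pos_of_pos (show 0 < A + b by linarith)).ne'
    field_simp

/-! ### The Dirichlet law in coordinates. -/

lemma volume_sum_eq_one (k : ℕ) : volume {y : Fin k → ℝ | ∑ i, y i = 1} = 0 := by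
  let S : AffineSubspace ℝ (Fin k → ℝ) :=
    { carrier := {y | ∑ i, y i = 1}
      smul_vsub_vadd_mem' := by
        intro c p q r hp hq hr
        simp only [mem_ofPred_eq] at *
        simp [Finset.sum_add_distrib, ← Finset.mul_sum, hp, hq, hr] }
  refine Measure.addHaar_affineSubspace volume S fun h => ?_
  have h0 : (0 : Fin k → ℝ) ∈ S := h ▸ AffineSubspace.mem_top ℝ _ _
  have : ∑ i : Fin k, (0 : Fin k → ℝ) i = 1 := h0
  simp at this

/-- The boundary lies in finitely many hyperplanes. Discarding it leaves only points with positive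
coordinates, where Dirichlet densities are positive and may be divided by. -/
lemma openCorner_ae_eq_projSimplex (k : ℕ) :
    openCorner k 1 =ᵐ[volume] projSimplex k := by
  refine (LE.le.eventuallyLE fun y hy => ?_).antisymm ?_
  · exact ⟨fun i => (hy.1 i).le, hy.2.le⟩
  · have h1 : ∀ᵐ y : Fin k → ℝ, ∀ i, y i ≠ 0 := by
      rw [ae_all_iff]
      intro i
      simpa [ae_iff, volume_pi] using
        Measure.pi_hyperplane (fun _ : Fin k => (volume : Measure ℝ)) i 0
    have h2 : ∀ᵐ y : Fin k → ℝ, ∑ i, y i ≠ 1 := by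
      simpa [ae_iff] using volume_sum_eq_one k
    filter_upwards [h1, h2] with y hy1 hy2 hy
    exact ⟨fun i => lt_of_le_of_ne (hy.1 i) (hy1 i).symm, lt_of_le_of_ne hy.2 hy2⟩

lemma continuous_simplexChart (k : ℕ) : Continuous (simplexChart (k := k)) := by
  refine continuous_pi fun i => ?_
  refine Fin.lastCases ?_ (fun j => ?_) i
  · simp only [simplexChart, Fin.snoc_last]; fun_prop
  · simp only [simplexChart, Fin.snoc_castSucc]; fun_prop

lemma sum_simplexChart {k : ℕ} (y : Fin k → ℝ) : ∑ i, simplexChart y i = 1 := by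
  simp [Fin.sum_univ_castSucc, simplexChart]

lemma simplexChart_pos {k : ℕ} {y : Fin k → ℝ} (hy : y ∈ openCorner k 1) (i : Fin (k + 1)) :
    0 < simplexChart y i := by
  refine Fin.lastCases ?_ (fun j => ?_) i
  · simpa [simplexChart] using hy.2
  · simpa [simplexChart] using hy.1 j

lemma multiBeta_pos {ι : Type*} [Fintype ι] [Nonempty ι] {α : ι → ℝ} (hα : ∀ i, 0 < α i) :
    0 < multiBeta α :=
  div_pos (Finset.prod_pos fun i _ => Real.Gamma_pos_of_pos (hα i))
    (Real.Gamma_pos_of_pos (Finset.sum_pos (fun i _ => hα i) Finset.univ_nonempty))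

lemma dirDensity_pos {ι : Type*} [Fintype ι] [Nonempty ι] {α θ : ι → ℝ} (hα : ∀ i, 0 < α i)
    (hθ : ∀ i, 0 < θ i) : 0 < dirDensity α θ :=
  mul_pos (one_div_pos.2 (multiBeta_pos hα))
    (Finset.prod_pos fun i _ => Real.rpow_pos_of_pos (hθ i) _)

lemma measurable_dirDensity {ι : Type*} [Fintype ι] (α : ι → ℝ) : Measurable (dirDensity α) := by
  unfold dirDensity; fun_prop

/-- The Dirichlet density in the coordinates of the projected simplex. -/
noncomputable def chartDensity {k : ℕ} (α : Fin (k + 1) → ℝ) (y : Fin k → ℝ) : ENNReal :=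
  ENNReal.ofReal (dirDensity α (simplexChart y))

lemma measurable_chartDensity {k : ℕ} (α : Fin (k + 1) → ℝ) : Measurable (chartDensity α) :=
  ((measurable_dirDensity α).comp (continuous_simplexChart k).measurable).ennreal_ofReal

lemma dirichlet_eq {k : ℕ} (α : Fin (k + 1) → ℝ) :
    dirichlet α =
      ((volume.restrict (openCorner k 1)).withDensity (chartDensity α)).map simplexChart := by
  rw [Measure.restrict_congr_set (openCorner_ae_eq_projSimplex k)]; rfl

/-- The normalising constant is the corner integral of size `1`. -/
lemma isProbabilityMeasure_dirichlet {k : ℕ} {α : Fin (k + 1) → ℝ} (hα : ∀ i, 0 < α i) :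
    IsProbabilityMeasure (dirichlet α) := by
  rw [dirichlet_eq]
  refine (Measure.isProbabilityMeasure_map_iff
    (continuous_simplexChart k).measurable.aemeasurable).2 ⟨?_⟩
  have hB := multiBeta_pos hα
  rw [withDensity_apply _ MeasurableSet.univ, Measure.restrict_univ]
  have h : ∀ y, chartDensity α y = ENNReal.ofReal (1 / multiBeta α) * ENNReal.ofReal
      ((∏ i : Fin k, y i ^ (α i.castSucc - 1)) * (1 - ∑ i, y i) ^ (α (Fin.last k) - 1)) := by
    intro y
    rw [chartDensity, ← ENNReal.ofReal_mul (by positivity)]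
    simp [dirDensity, Fin.prod_univ_castSucc, simplexChart]
  simp only [h]
  rw [lintegral_const_mul' _ _ ENNReal.ofReal_ne_top,
    lintegral_openCorner k _ (fun i => hα _) (hα _) one_pos, Real.one_rpow, one_mul,
    ← Fin.prod_univ_castSucc (fun i => Real.Gamma (α i)), ← Fin.sum_univ_castSucc (fun i => α i),
    ← multiBeta, ← ENNReal.ofReal_mul (by positivity), one_div, inv_mul_cancel₀ hB.ne',
    ENNReal.ofReal_one]

lemma ae_dirichlet_of_openCorner {k : ℕ} (α : Fin (k + 1) → ℝ) {p : (Fin (k + 1) → ℝ) → Prop}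
    (hp : MeasurableSet {θ | p θ}) (h : ∀ y ∈ openCorner k 1, p (simplexChart y)) :
    ∀ᵐ θ ∂(dirichlet α), p θ := by
  rw [dirichlet_eq, ae_map_iff (continuous_simplexChart k).measurable.aemeasurable hp]
  refine (withDensity_absolutelyContinuous _ _).ae_le ?_
  filter_upwards [ae_restrict_mem (isOpen_openCorner k 1).measurableSet] with y hy using h y hy

lemma ae_dirichlet_pos {k : ℕ} (α : Fin (k + 1) → ℝ) :
    ∀ᵐ θ ∂(dirichlet α), ∀ i, 0 < θ i := by
  refine ae_dirichlet_of_openCorner α ?_ fun y hy i => simplexChart_pos hy i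
  simp only [ofPred_forall]
  exact MeasurableSet.iInter fun i => measurableSet_lt measurable_const (measurable_pi_apply i)

lemma ae_dirichlet_mem_stdSimplex {k : ℕ} (α : Fin (k + 1) → ℝ) :
    ∀ᵐ θ ∂(dirichlet α), θ ∈ stdSimplex ℝ (Fin (k + 1)) :=
  ae_dirichlet_of_openCorner α (isClosed_stdSimplex ℝ _).measurableSet fun y hy =>
    ⟨fun i => (simplexChart_pos hy i).le, sum_simplexChart y⟩

/-- The density of one Dirichlet distribution with respect to another. -/
lemma dirichlet_eq_withDensity {k : ℕ} (α : Fin (k + 1) → ℝ) {β : Fin (k + 1) → ℝ}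
    (hβ : ∀ i, 0 < β i) :
    dirichlet α = (dirichlet β).withDensity
      fun θ => ENNReal.ofReal (dirDensity α θ / dirDensity β θ) := by
  have hc := (continuous_simplexChart k).measurable
  have hr : Measurable fun θ : Fin (k + 1) → ℝ =>
      ENNReal.ofReal (dirDensity α θ / dirDensity β θ) :=
    ((measurable_dirDensity α).div (measurable_dirDensity β)).ennreal_ofReal
  ext A hA
  rw [withDensity_apply _ hA, dirichlet_eq, dirichlet_eq, setLIntegral_map hA hr hc,
    Measure.map_apply hc hA, withDensity_apply _ (hc hA),
    setLIntegral_withDensity_eq_setLIntegral_mul _ (measurable_chartDensity β)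
      (by exact hr.comp hc) (hc hA)]
  refine lintegral_congr_ae (ae_restrict_of_ae ?_)
  filter_upwards [ae_restrict_mem (isOpen_openCorner k 1).measurableSet] with y hy
  have h1 := dirDensity_pos hβ (simplexChart_pos hy)
  simp only [Pi.mul_apply, chartDensity]
  rw [← ENNReal.ofReal_mul h1.le, mul_div_cancel₀ _ h1.ne']

/-- An open set that meets the simplex has positive Dirichlet probability. -/
lemma dirichlet_pos_of_isOpen {k : ℕ} {α : Fin (k + 1) → ℝ} (hα : ∀ i, 0 < α i)
    {U : Set (Fin (k + 1) → ℝ)} (hU : IsOpen U) {θ : Fin (k + 1) → ℝ} (hθU : θ ∈ U)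
    (hθ : θ ∈ stdSimplex ℝ (Fin (k + 1))) : 0 < dirichlet α U := by
  have hc := continuous_simplexChart k
  -- Move from `θ` slightly towards the barycentre: all coordinates become positive while the point
  -- stays in `U`.
  set ψ : ℝ → Fin (k + 1) → ℝ := fun t i => (1 - t) * θ i + t * (1 / (k + 1)) with hψ
  have hψc : Continuous ψ := by fun_prop
  have hψ0 : ψ 0 = θ := by ext; simp [hψ]
  have hev : ∀ᶠ t in 𝓝[>] (0 : ℝ), ψ t ∈ U ∧ t < 1 := by
    refine Filter.Eventually.filter_mono nhdsWithin_le_nhds ?_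
    exact (hψc.continuousAt.eventually_mem (by rw [hψ0]; exact hU.mem_nhds hθU)).and
      (gt_mem_nhds one_pos)
  obtain ⟨t, ⟨htU, ht1⟩, ht0⟩ := (hev.and self_mem_nhdsWithin).exists
  have ht0 : 0 < t := ht0
  have hpos : ∀ i, 0 < ψ t i := fun i => by
    have := mul_nonneg (sub_pos.2 ht1).le (hθ.1 i)
    have : 0 < t * (1 / ((k : ℝ) + 1)) := by positivity
    simp only [hψ]; linarith
  have hsum : ∑ i, ψ t i = 1 := by
    have hk : (k : ℝ) + 1 ≠ 0 := by positivity
    simp only [hψ, Finset.sum_add_distrib, ← Finset.mul_sum, hθ.2]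
    simp [hk]
  rw [Fin.sum_univ_castSucc] at hsum
  have hchart : simplexChart (fun i : Fin k => ψ t i.castSucc) = ψ t := by
    ext i
    refine Fin.lastCases ?_ (fun j => ?_) i
    · simp only [simplexChart, Fin.snoc_last]; linarith
    · simp [simplexChart]
  have hmem : (fun i : Fin k => ψ t i.castSucc) ∈ openCorner k 1 :=
    ⟨fun i => hpos _, by have := hpos (Fin.last k); linarith⟩
  rw [dirichlet_eq, Measure.map_apply hc.measurable hU.measurableSet, pos_iff_ne_zero]
  intro h0
  -- The density is positive on the corner, so a Dirichlet-null set would pull back to a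
  -- Lebesgue-null set there, impossible for a nonempty open one.
  have hac : volume.restrict (openCorner k 1) ≪
      (volume.restrict (openCorner k 1)).withDensity (chartDensity α) := by
    refine withDensity_absolutelyContinuous' (measurable_chartDensity α).aemeasurable ?_
    filter_upwards [ae_restrict_mem (isOpen_openCorner k 1).measurableSet] with y hy
    simpa [chartDensity] using dirDensity_pos hα (simplexChart_pos hy)
  have h1 := hac h0
  rw [Measure.restrict_apply (hc.measurable hU.measurableSet)] at h1
  exact (((hU.preimage hc).inter (isOpen_openCorner k 1)).measure_pos volume
    ⟨_, by rw [mem_preimage, hchart]; exact htU, hmem⟩).ne' h1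

/-! ### The scaled exponential on extended reals. -/

lemma expScaled_coe (n x : ℝ) : expScaled n (x : EReal) = Real.exp (n * x) := by
  rw [expScaled, ← EReal.coe_mul, EReal.exp_coe, ENNReal.toReal_ofReal (Real.exp_pos _).le]

lemma expScaled_bot {n : ℝ} (hn : 0 < n) : expScaled n ⊥ = 0 := by
  rw [expScaled, EReal.coe_mul_bot_of_pos hn, EReal.exp_bot, ENNReal.toReal_zero]

lemma expScaled_nonneg (n : ℝ) (x : EReal) : 0 ≤ expScaled n x := ENNReal.toReal_nonneg

lemma expScaled_le {n : ℝ} (hn : 0 < n) {x : EReal} {c : ℝ} (hx : x ≤ c) :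
    expScaled n x ≤ Real.exp (n * c) := by
  induction x with
  | bot => rw [expScaled_bot hn]; exact (Real.exp_pos _).le
  | coe x =>
    rw [expScaled_coe, Real.exp_le_exp]
    exact mul_le_mul_of_nonneg_left (EReal.coe_le_coe_iff.1 hx) hn.le
  | top => exact absurd hx (not_le.2 (EReal.coe_lt_top c))

/-- The value `⊤` must be excluded because `toReal` sends an infinite exponential to `0`. -/
lemma le_expScaled {n : ℝ} (hn : 0 < n) {x : EReal} {b : ℝ} (hx : b ≤ x) (hx' : x ≠ ⊤) :
    Real.exp (n * b) ≤ expScaled n x := by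
  induction x with
  | bot => exact absurd hx (not_le.2 (EReal.bot_lt_coe b))
  | coe x =>
    rw [expScaled_coe, Real.exp_le_exp]
    exact mul_le_mul_of_nonneg_left (EReal.coe_le_coe_iff.1 hx) hn.le
  | top => exact absurd rfl hx'

lemma measurable_expScaled (n : ℝ) : Measurable (expScaled n) := by
  unfold expScaled
  fun_prop

/-! ### Variance of the Monte Carlo estimator. -/

/-- A square-integrable random variable with mass above `u` and below `l` has large variance. -/
lemma le_variance_of_separated {Ω : Type*} {mΩ : MeasurableSpace Ω} {μ : Measure Ω}
    [IsProbabilityMeasure μ] {X : Ω → ℝ} (hX : MemLp X 2 μ) {B C : Set Ω} {l u : ℝ} (hlu : l < u)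
    (hB : ∀ ω ∈ B, u ≤ X ω) (hC : ∀ ω ∈ C, X ω ≤ l) :
    min (μ.real B) (μ.real C) * ((u - l) / 2) ^ 2 ≤ variance X μ := by
  have hc : 0 < (u - l) / 2 := by linarith
  have h := meas_ge_le_variance_div_sq hX hc
  have h' : μ.real {ω | (u - l) / 2 ≤ |X ω - μ[X]|} ≤ variance X μ / ((u - l) / 2) ^ 2 :=
    ENNReal.toReal_le_of_le_ofReal (div_nonneg (variance_nonneg _ _) (sq_nonneg _)) h
  rw [← le_div_iff₀ (by positivity)]
  refine le_trans ?_ h'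
  -- The mean lies on one side of the midpoint, so `B` or `C` is at distance at least `(u - l) / 2`
  -- from it, and Chebyshev's inequality applies.
  rcases le_total μ[X] ((u + l) / 2) with hm | hm
  · refine (min_le_left _ _).trans (measureReal_mono fun ω hω => ?_)
    have h1 : (u - l) / 2 ≤ X ω - μ[X] := by linarith [hB ω hω]
    exact h1.trans (le_abs_self _)
  · refine (min_le_right _ _).trans (measureReal_mono fun ω hω => ?_)
    have h1 : (u - l) / 2 ≤ -(X ω - μ[X]) := by linarith [hC ω hω]
    exact h1.trans (neg_le_abs _)

lemma aemeasurable_dirichlet_of_continuousOn {k : ℕ} (α : Fin (k + 1) → ℝ)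
    {H : (Fin (k + 1) → ℝ) → EReal} (hH : ContinuousOn H (stdSimplex ℝ (Fin (k + 1)))) :
    AEMeasurable H (dirichlet α) := by
  have h := hH.aemeasurable (μ := dirichlet α) (isClosed_stdSimplex ℝ _).measurableSet
  rwa [Measure.restrict_eq_self_of_ae_mem (ae_dirichlet_mem_stdSimplex α)] at h

lemma memLp_expScaled {k : ℕ} {α : Fin (k + 1) → ℝ} (hα : ∀ i, 0 < α i)
    {H : (Fin (k + 1) → ℝ) → EReal} (hH : ContinuousOn H (stdSimplex ℝ (Fin (k + 1)))) {h n : ℝ}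
    (hn : 0 < n) (hle : ∀ θ ∈ stdSimplex ℝ (Fin (k + 1)), H θ ≤ h) :
    MemLp (fun θ => expScaled n (H θ)) 2 (dirichlet α) := by
  have := isProbabilityMeasure_dirichlet hα
  refine MemLp.of_bound ((measurable_expScaled n).comp_aemeasurable
    (aemeasurable_dirichlet_of_continuousOn α hH)).aestronglyMeasurable (Real.exp (n * h)) ?_
  filter_upwards [ae_dirichlet_mem_stdSimplex α] with θ hθ
  rw [Real.norm_of_nonneg (expScaled_nonneg _ _)]
  exact expScaled_le hn (hle θ hθ)

lemma memLp_mcEstimator {k : ℕ} {α : Fin (k + 1) → ℝ} (hα : ∀ i, 0 < α i)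
    {H : (Fin (k + 1) → ℝ) → EReal} {n : ℝ}
    (hX : MemLp (fun θ => expScaled n (H θ)) 2 (dirichlet α)) (N : ℕ) :
    MemLp (mcEstimator N H n) 2 (iidDirichlet N α) := by
  have := isProbabilityMeasure_dirichlet hα
  have h : ∀ i : Fin N, MemLp (fun s : Fin N → Fin (k + 1) → ℝ => expScaled n (H (s i))) 2
      (iidDirichlet N α) := fun i =>
    hX.comp_measurePreserving (measurePreserving_eval (fun _ : Fin N => dirichlet α) i)
  exact (memLp_finsetSum Finset.univ fun i _ => h i).const_mul (1 / (N : ℝ))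

lemma mcVar_eq {k : ℕ} {α : Fin (k + 1) → ℝ} (hα : ∀ i, 0 < α i)
    {H : (Fin (k + 1) → ℝ) → EReal} {n : ℝ}
    (hX : MemLp (fun θ => expScaled n (H θ)) 2 (dirichlet α)) {N : ℕ} (hN : 1 ≤ N) :
    mcVar N α H n = variance (fun θ => expScaled n (H θ)) (dirichlet α) / N := by
  have := isProbabilityMeasure_dirichlet hα
  have hN' : (N : ℝ) ≠ 0 := by positivity
  have h := variance_sum_pi (μ := fun _ : Fin N => dirichlet α) (fun _ => hX)
  have e : mcEstimator N H n = fun s => (1 / (N : ℝ)) *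
      (∑ i : Fin N, fun s : Fin N → Fin (k + 1) → ℝ => expScaled n (H (s i))) s := by
    ext s; simp [mcEstimator]
  rw [mcVar, e, variance_const_mul, iidDirichlet, h]
  simp
  field_simp

/-! ### Bias of the importance sampling estimator. -/

/-- The importance sampling integrand. -/
noncomputable def isIntegrand {k : ℕ} (α β : Fin (k + 1) → ℝ) (T : Set (Fin (k + 1) → ℝ))
    (f : (Fin (k + 1) → ℝ) → ℝ) : (Fin (k + 1) → ℝ) → ℝ :=
  T.indicator fun θ => f θ * (dirDensity α θ / dirDensity β θ)

/-- The weight is the density of one Dirichlet law against the other, so weighting changes the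
measure back. -/
lemma integrable_isIntegrand {k : ℕ} {α β : Fin (k + 1) → ℝ} (hα : ∀ i, 0 < α i)
    (hβ : ∀ i, 0 < β i) {T : Set (Fin (k + 1) → ℝ)} (hT : MeasurableSet T)
    {f : (Fin (k + 1) → ℝ) → ℝ} (hf : Integrable f (dirichlet α)) :
    Integrable (isIntegrand α β T f) (dirichlet β) ∧
      ∫ θ, isIntegrand α β T f θ ∂(dirichlet β) = ∫ θ in T, f θ ∂(dirichlet α) := by
  set r : (Fin (k + 1) → ℝ) → ENNReal :=
    fun θ => ENNReal.ofReal (dirDensity α θ / dirDensity β θ) with hr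
  have hrm : Measurable r :=
    ((measurable_dirDensity α).div (measurable_dirDensity β)).ennreal_ofReal
  have hrt : ∀ᵐ θ ∂(dirichlet β), r θ < ⊤ := ae_of_all _ fun _ => ENNReal.ofReal_lt_top
  have hE : (fun θ => (r θ).toReal • T.indicator f θ) =ᵐ[dirichlet β] isIntegrand α β T f := by
    filter_upwards [ae_dirichlet_pos β] with θ hθ
    rw [hr, ENNReal.toReal_ofReal (div_pos (dirDensity_pos hα hθ) (dirDensity_pos hβ hθ)).le,
      isIntegrand, smul_eq_mul]
    by_cases h : θ ∈ T
    · rw [indicator_of_mem h, indicator_of_mem h, mul_comm]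
    · rw [indicator_of_notMem h, indicator_of_notMem h, mul_zero]
  have hD := dirichlet_eq_withDensity α hβ
  constructor
  · refine Integrable.congr ?_ hE
    rw [← integrable_withDensity_iff_integrable_smul' hrm hrt, ← hD]
    exact hf.indicator hT
  · rw [← integral_congr_ae hE, ← integral_withDensity_eq_integral_toReal_smul hrm hrt, ← hD,
      integral_indicator hT]

lemma measurableSet_truncSimplex {k : ℕ} (θstar : Fin (k + 1) → ℝ) (ε : ℝ) :
    MeasurableSet (truncSimplex θstar ε) := by
  have h : truncSimplex θstar ε =
      stdSimplex ℝ (Fin (k + 1)) ∩ ⋂ i, ⋂ (_ : 0 < θstar i), {θ | ε ≤ θ i} := by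
    ext; simp [truncSimplex]
  rw [h]
  exact (isClosed_stdSimplex ℝ _).measurableSet.inter (MeasurableSet.iInter fun i =>
    MeasurableSet.iInter fun _ => measurableSet_le measurable_const (measurable_pi_apply i))

lemma isParam_pos {k : ℕ} {α θstar : Fin (k + 1) → ℝ} (hα : ∀ i, 0 < α i)
    (hθ : ∀ i, 0 ≤ θstar i) (γ : ℝ) {n : ℝ} (hn : 0 < n) (i : Fin (k + 1)) :
    0 < isParam α θstar γ n i :=
  add_pos_of_pos_of_nonneg (hα i) (mul_nonneg (Real.rpow_nonneg hn.le _) (hθ i))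

lemma integrable_isEstimator {k : ℕ} {α θstar : Fin (k + 1) → ℝ} (hα : ∀ i, 0 < α i)
    (hθ : ∀ i, 0 ≤ θstar i) (ε γ : ℝ) {n : ℝ} (hn : 0 < n) {H : (Fin (k + 1) → ℝ) → EReal}
    (hX : Integrable (fun θ => expScaled n (H θ)) (dirichlet α)) (N : ℕ) :
    Integrable (isEstimator N α θstar ε γ H n) (iidDirichlet N (isParam α θstar γ n)) := by
  have hβ := isParam_pos hα hθ γ hn
  have := isProbabilityMeasure_dirichlet hβ
  refine Integrable.const_mul (integrable_finsetSum _ fun i _ => ?_) _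
  exact (measurePreserving_eval (fun _ : Fin N => dirichlet (isParam α θstar γ n)) i
    ).integrable_comp_of_integrable
      (integrable_isIntegrand hα hβ (measurableSet_truncSimplex θstar ε) hX).1

/-- The bias is the mass of the truncated region. -/
lemma isBias_eq {k : ℕ} {α θstar : Fin (k + 1) → ℝ} (hα : ∀ i, 0 < α i)
    (hθ : ∀ i, 0 ≤ θstar i) (ε γ : ℝ) {n : ℝ} (hn : 0 < n) {H : (Fin (k + 1) → ℝ) → EReal}
    (hX : Integrable (fun θ => expScaled n (H θ)) (dirichlet α)) {N : ℕ} (hN : 1 ≤ N) :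
    isBias N α θstar ε γ H n =
      -∫ θ in (truncSimplex θstar ε)ᶜ, expScaled n (H θ) ∂(dirichlet α) := by
  have hβ := isParam_pos hα hθ γ hn
  have := isProbabilityMeasure_dirichlet hβ
  have hT := measurableSet_truncSimplex θstar ε
  obtain ⟨hi, he⟩ := integrable_isIntegrand hα hβ hT hX
  have hN' : (N : ℝ) ≠ 0 := by positivity
  have h1 : ∫ s, isEstimator N α θstar ε γ H n s ∂(iidDirichlet N (isParam α θstar γ n)) =
      ∫ θ in truncSimplex θstar ε, expScaled n (H θ) ∂(dirichlet α) := by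
    change ∫ s, (1 / (N : ℝ)) * ∑ i, isIntegrand α (isParam α θstar γ n) (truncSimplex θstar ε)
      (fun θ => expScaled n (H θ)) (s i) ∂(Measure.pi fun _ => _) = _
    rw [integral_const_mul, integral_finsetSum _ fun i _ => by
      exact (measurePreserving_eval (fun _ : Fin N => dirichlet (isParam α θstar γ n)) i
        ).integrable_comp_of_integrable hi]
    rw [Finset.sum_congr rfl fun i _ => (integral_comp_eval (ι := Fin N)
      (μ := fun _ => dirichlet (isParam α θstar γ n)) hi.aestronglyMeasurable).trans he]
    simp [hN']
  rw [isBias, h1, estimand, ← integral_add_compl hT hX]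
  ring

lemma abs_isBias_le {k : ℕ} {α θstar : Fin (k + 1) → ℝ} (hα : ∀ i, 0 < α i)
    (hθ : ∀ i, 0 ≤ θstar i) (ε γ : ℝ) {n : ℝ} (hn : 0 < n) {H : (Fin (k + 1) → ℝ) → EReal}
    (hX : Integrable (fun θ => expScaled n (H θ)) (dirichlet α)) {N : ℕ} (hN : 1 ≤ N) {c : ℝ}
    (hc : ∀ θ ∈ stdSimplex ℝ (Fin (k + 1)), θ ∉ truncSimplex θstar ε → H θ ≤ c) :
    |isBias N α θstar ε γ H n| ≤ Real.exp (n * c) := by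
  have := isProbabilityMeasure_dirichlet hα
  rw [isBias_eq hα hθ ε γ hn hX hN, abs_neg, ← Real.norm_eq_abs]
  refine (norm_setIntegral_le_of_norm_le_const_ae' (measure_lt_top _ _)
    (C := Real.exp (n * c)) ?_).trans ?_
  · filter_upwards [ae_dirichlet_mem_stdSimplex α] with θ hθ hθT
    rw [Real.norm_of_nonneg (expScaled_nonneg _ _)]
    exact expScaled_le hn (hc θ hθ hθT)
  · exact mul_le_of_le_one_right (Real.exp_pos _).le measureReal_le_one

/-! ### Level sets of `H` on the simplex. -/

/-- Outside the truncated simplex `H` stays below its maximum. -/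
lemma exists_lt_of_notMem_truncSimplex {k : ℕ} {θstar : Fin (k + 1) → ℝ}
    {H : (Fin (k + 1) → ℝ) → EReal} (hmax : UniqueMax H θstar)
    (hH : ContinuousOn H (stdSimplex ℝ (Fin (k + 1)))) {ε : ℝ}
    (hεθ : ∀ i, 0 < θstar i → ε < θstar i) (hbot : H θstar ≠ ⊥) :
    ∃ c : ℝ, (c : EReal) < H θstar ∧
      ∀ θ ∈ stdSimplex ℝ (Fin (k + 1)), θ ∉ truncSimplex θstar ε → H θ ≤ c := by
  -- The non-strict `θ i ≤ ε` makes `D` closed, hence compact; `ε < θstar i` keeps `θstar` out.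
  set D : Set (Fin (k + 1) → ℝ) :=
    stdSimplex ℝ (Fin (k + 1)) ∩ ⋃ i ∈ {i | 0 < θstar i}, {θ | θ i ≤ ε} with hD
  have hDc : IsCompact D := (isCompact_stdSimplex ℝ _).inter_right
    ((toFinite _).isClosed_biUnion fun i _ => isClosed_le (continuous_apply i) continuous_const)
  have hsub : ∀ θ ∈ stdSimplex ℝ (Fin (k + 1)), θ ∉ truncSimplex θstar ε → θ ∈ D := by
    intro θ hθ hθT
    simp only [truncSimplex, mem_ofPred_eq, not_and, not_forall, not_le] at hθT
    obtain ⟨i, hi, hi'⟩ := hθT hθ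
    exact ⟨hθ, mem_biUnion (show i ∈ {i | 0 < θstar i} from hi) hi'.le⟩
  -- The maximum over `D` may be `⊥`, so a real bound is only inserted afterwards.
  obtain ⟨x, hx, hxD⟩ : ∃ x : EReal, x < H θstar ∧ ∀ θ ∈ D, H θ ≤ x := by
    rcases D.eq_empty_or_nonempty with he | hne
    · exact ⟨⊥, bot_lt_iff_ne_bot.2 hbot, by simp [he]⟩
    · obtain ⟨θ, hθ, hθm⟩ := hDc.exists_isMaxOn hne (hH.mono inter_subset_left)
      refine ⟨H θ, hmax.2 θ hθ.1 ?_, fun y hy => hθm hy⟩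
      rintro rfl
      obtain ⟨i, hi, hi'⟩ := mem_iUnion₂.1 hθ.2
      exact absurd hi' (not_le.2 (hεθ i hi))
  obtain ⟨c, hc, hc'⟩ := EReal.lt_iff_exists_real_btwn.1 hx
  exact ⟨c, hc', fun θ hθ hθT => (hxD θ (hsub θ hθ hθT)).trans hc.le⟩

/-- A preimage of an open set under `H`, if it meets the simplex, has positive probability. -/
lemma dirichlet_preimage_pos {k : ℕ} {α : Fin (k + 1) → ℝ} (hα : ∀ i, 0 < α i)
    {H : (Fin (k + 1) → ℝ) → EReal} (hH : ContinuousOn H (stdSimplex ℝ (Fin (k + 1))))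
    {V : Set EReal} (hV : IsOpen V) {θ : Fin (k + 1) → ℝ} (hθ : θ ∈ stdSimplex ℝ (Fin (k + 1)))
    (hθV : H θ ∈ V) : 0 < (dirichlet α).real (H ⁻¹' V) := by
  have := isProbabilityMeasure_dirichlet hα
  obtain ⟨U, hU, hUV⟩ := continuousOn_iff'.1 hH V hV
  have hθU : θ ∈ U := (hUV ▸ ⟨hθV, hθ⟩ : θ ∈ U ∩ stdSimplex ℝ (Fin (k + 1))).1
  have hle : dirichlet α U ≤ dirichlet α (H ⁻¹' V) := by
    refine measure_mono_ae ?_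
    filter_upwards [ae_dirichlet_mem_stdSimplex α] with η hη hηU
    exact (hUV.symm ▸ ⟨hηU, hη⟩ : η ∈ H ⁻¹' V ∩ stdSimplex ℝ (Fin (k + 1))).1
  exact ENNReal.toReal_pos ((dirichlet_pos_of_isOpen hα hU hθU hθ).trans_le hle).ne'
    (measure_ne_top _ _)

lemma exists_ne_mem_stdSimplex {k : ℕ} (hk : 1 ≤ k) (θ : Fin (k + 1) → ℝ) :
    ∃ η ∈ stdSimplex ℝ (Fin (k + 1)), η ≠ θ := by
  by_cases h : θ = Pi.single 0 1
  · refine ⟨Pi.single (Fin.last k) 1, single_mem_stdSimplex ℝ _, fun h' => ?_⟩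
    have h1 := congrFun (h'.trans h) 0
    have h0 : (0 : Fin (k + 1)) ≠ Fin.last k := by
      simp [Fin.ext_iff]; omega
    simp [Pi.single_eq_of_ne h0] at h1
  · exact ⟨Pi.single 0 1, single_mem_stdSimplex ℝ _, fun h' => h h'.symm⟩

end DirichletIS

/-! ### Comparison of exponential rates. -/

theorem mainTheorem9 (k : ℕ) (hk : 1 ≤ k)
    (α : Fin (k + 1) → ℝ) (hα : ∀ i, 0 < α i)
    (H : (Fin (k + 1) → ℝ) → EReal) (hH : ∀ θ, H θ ≠ ⊤)
    (θstar : Fin (k + 1) → ℝ)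
    (hA1 : UniqueMax H θstar) (hA2 : Regular H θstar)
    (hA3 : StrictComplementarity H θstar) (hA4 : HessianNegDef H θstar)
    (ε : ℝ) (hε : 0 < ε) (hεθ : ∀ i, 0 < θstar i → ε < θstar i) :
    ∃ δ : ℝ, 0 < δ ∧ ∀ γ : ℝ, 0 < γ → γ < 1 → ∀ N : ℕ, 1 ≤ N →
      (∀ n : ℝ, 0 < n →
        Integrable (isEstimator N α θstar ε γ H n) (iidDirichlet N (isParam α θstar γ n)) ∧
        MemLp (mcEstimator N H n) 2 (iidDirichlet N α) ∧ 0 < mcVar N α H n) ∧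
      (fun n : ℝ => isBias N α θstar ε γ H n ^ 2 / mcVar N α H n)
        =O[atTop] fun n : ℝ => Real.exp (-2 * n * δ) := by
  have := isProbabilityMeasure_dirichlet hα
  obtain ⟨hcont, U, -, hθU, hUbot, -⟩ := hA2
  have hbot := hUbot θstar hθU
  have hθ0 := hA1.1.1
  obtain ⟨h, hh⟩ : ∃ h : ℝ, H θstar = h := ⟨_, (EReal.coe_toReal (hH _) hbot).symm⟩
  have hle : ∀ θ ∈ stdSimplex ℝ (Fin (k + 1)), H θ ≤ h := fun θ hθ => by
    rcases eq_or_ne θ θstar with rfl | hne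
    · exact hh.le
    · exact hh ▸ (hA1.2 θ hθ hne).le
  obtain ⟨c, hc, hcD⟩ := exists_lt_of_notMem_truncSimplex hA1 hcont hεθ hbot
  obtain ⟨θ₁, hθ₁, hne⟩ := exists_ne_mem_stdSimplex hk θstar
  obtain ⟨l, hl, hlh⟩ := EReal.lt_iff_exists_real_btwn.1 (hA1.2 θ₁ hθ₁ hne)
  rw [hh, EReal.coe_lt_coe_iff] at hc hlh
  -- `b > l` separates the two events; `b > (c + h) / 2` gives `b - c > (h - c) / 2`, the rate `δ`
  -- used below.
  obtain ⟨b, hb, hbh⟩ := exists_between (max_lt hlh (show (c + h) / 2 < h by linarith))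
  obtain ⟨hlb, hcb⟩ := max_lt_iff.1 hb
  set m : ℝ := min ((dirichlet α).real (H ⁻¹' Set.Ioi (b : EReal)))
    ((dirichlet α).real (H ⁻¹' Set.Iio (l : EReal))) with hm
  have hm0 : 0 < m := lt_min
    (dirichlet_preimage_pos hα hcont isOpen_Ioi hA1.1
      (by rw [hh]; exact EReal.coe_lt_coe_iff.2 hbh))
    (dirichlet_preimage_pos hα hcont isOpen_Iio hθ₁ hl)
  have hX : ∀ n : ℝ, 0 < n → MemLp (fun θ => expScaled n (H θ)) 2 (dirichlet α) :=
    fun n hn => memLp_expScaled hα hcont hn hle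
  have hexp : ∀ n : ℝ, 0 < n → Real.exp (n * l) < Real.exp (n * b) := fun n hn =>
    Real.exp_lt_exp.2 (mul_lt_mul_of_pos_left hlb hn)
  have hvar : ∀ n : ℝ, 0 < n → ∀ N : ℕ, 1 ≤ N →
      m * ((Real.exp (n * b) - Real.exp (n * l)) / 2) ^ 2 / N ≤ mcVar N α H n := by
    intro n hn N hN
    rw [mcVar_eq hα (hX n hn) hN]
    gcongr
    exact le_variance_of_separated (hX n hn) (hexp n hn)
      (fun θ hθ => le_expScaled hn (le_of_lt hθ) (hH θ))
      (fun θ hθ => expScaled_le hn (le_of_lt hθ))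
  refine ⟨(h - c) / 2, by linarith, fun γ _ _ N hN => ⟨fun n hn => ⟨?_, ?_, ?_⟩, ?_⟩⟩
  · exact integrable_isEstimator hα hθ0 ε γ hn ((hX n hn).integrable one_le_two) N
  · exact memLp_mcEstimator hα (hX n hn) N
  · refine lt_of_lt_of_le ?_ (hvar n hn N hN)
    have := sub_pos.2 (hexp n hn)
    positivity
  · have hN0 : (0 : ℝ) < N := by exact_mod_cast hN
    -- Eventually `e^{nl}` is below half of `e^{nb}`, so half the gap between them is at least
    -- `e^{nb} / 4`.
    have hlim : Tendsto (fun n : ℝ => Real.exp (n * (l - b))) atTop (𝓝 0) :=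
      Real.tendsto_exp_atBot.comp (tendsto_id.atTop_mul_const_of_neg (sub_neg.2 hlb))
    -- The `16` is the square of that `4`. `N` enters only this constant, never the rate.
    refine IsBigO.of_bound (16 * N / m) ?_
    filter_upwards [eventually_gt_atTop 0, hlim.eventually_lt_const (show (0 : ℝ) < 1 / 2 by
      norm_num)] with n hn hn2
    have hV : m * (Real.exp (n * b) / 4) ^ 2 / N ≤ mcVar N α H n := by
      refine le_trans ?_ (hvar n hn N hN)
      have h2 : Real.exp (n * l) = Real.exp (n * b) * Real.exp (n * (l - b)) := by
        rw [← Real.exp_add]; ring_nf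
      have h3 : Real.exp (n * b) / 4 ≤ (Real.exp (n * b) - Real.exp (n * l)) / 2 := by
        rw [h2]; nlinarith [Real.exp_pos (n * b)]
      gcongr
    have hV0 : 0 < m * (Real.exp (n * b) / 4) ^ 2 / N := by positivity
    have hbias : isBias N α θstar ε γ H n ^ 2 ≤ Real.exp (n * c) ^ 2 := by
      rw [← sq_abs]
      exact pow_le_pow_left₀ (abs_nonneg _)
        (abs_isBias_le hα hθ0 ε γ hn ((hX n hn).integrable one_le_two) hN hcD) 2
    rw [Real.norm_of_nonneg (div_nonneg (sq_nonneg _) (hV0.le.trans hV)),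
      Real.norm_of_nonneg (Real.exp_pos _).le]
    calc isBias N α θstar ε γ H n ^ 2 / mcVar N α H n
        ≤ Real.exp (n * c) ^ 2 / (m * (Real.exp (n * b) / 4) ^ 2 / N) := by gcongr
      _ = 16 * N / m * (Real.exp (n * c) ^ 2 / Real.exp (n * b) ^ 2) := by
        field_simp
        norm_num
      _ ≤ 16 * N / m * Real.exp (-2 * n * ((h - c) / 2)) := by
        gcongr
        rw [← Real.exp_nat_mul, ← Real.exp_nat_mul, ← Real.exp_sub, Real.exp_le_exp]
        push_cast
        nlinarith
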